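/- Let $E$ be a complex Hilbert space and let $H_s$, $W_s$, $\rho_s(0)$ be bounded linear operators on $E$, with $H_s$ and $W_s$ Hermitian (self-adjoint); $\|\cdot\|$ is the operator norm. Let $B:\mathbb R\times\mathbb R\to\mathbb C$ satisfy $|B(\tau_1,\tau_2)|\le\bar B$ for all $\tau_1,\tau_2$, and suppose that for all nonzero $\tau_1,\tau_2$ the partial derivatives of $B$ exist and $|\partial_{\tau_1}B(\tau_1,\tau_2)|+|\partial_{\tau_2}B(\tau_1,\tau_2)|\le\bar B'$. For a finite sequence of times put $$\mathcal L_b(\tau_1,\dots,\tau_k)=\sum_{\mathfrak q}\ \prod_{(i,j)\in\mathfrak q,\ i<j}B(\tau_i,\tau_j),$$ where $\mathfrak q$ runs over all partitions of $\{1,\dots,k\}$ into pairs (so $\mathcal L_b=1$ for $k=0$ and $\mathcal L_b=0$ for odd $k$). For $t\ge 0$ define $$\rho_s(t)=\sum_{m=0}^{\infty}\sum_{m'=0}^{\infty}(-\mathrm i)^m\,\mathrm i^{m'}\!\!\int_{0<t_1<\dots<t_m<t}\int_{0<t_1'<\dots<t'_{m'}<t}\mathrm e^{-\mathrm iH_s(t-t_m)}W_s\,\mathrm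 e^{-\mathrm iH_s(t_m-t_{m-1})}W_s\cdots W_s\,\mathrm e^{-\mathrm iH_st_1}\,\rho_s(0)\,\mathrm e^{\mathrm iH_st_1'}W_s\cdots W_s\,\mathrm e^{\mathrm iH_s(t-t'_{m'})}\,\mathcal L_b(-t_m,\dots,-t_1,t_1',\dots,t'_{m'})\,\mathrm dt'\,\mathrm dt .$$ For $\Delta t>0$ let $\mathcal P_0=\mathrm e^{-\mathrm iH_s\Delta t}$ and $\mathcal P_1=-\mathrm i\Delta t\,\mathrm e^{-\mathrm iH_s\Delta t/2}W_s\,\mathrm e^{-\mathrm iH_s\Delta t/2}$, and for $n\ge 0$ let $$\rho_{s,n}=\sum_{j^-,\,j^+\in\{0,1\}^n}\mathcal P_{j^-_n}\cdots\mathcal P_{j^-_1}\,\rho_s(0)\,\mathcal P_{j^+_1}^\dagger\cdots\mathcal P_{j^+_n}^\dagger\ \mathcal L_b\big(-(k^-_{m_-}-\tfrac12)\Delta t,\dots,-(k^-_1-\tfrac12)\Delta t,\,(k^+_1-\tfrac12)\Delta t,\dots,(k^+_{m_+}-\tfrac12)\Delta t\big),$$ where $k^\pm_1<\dots<k^\pm_{m_\pm}$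 are the indices $k$ with $j^\pm_k=1$. Then all the integrals in the definition of $\rho_s(n\Delta t)$ converge absolutely, the double series for $\rho_s(n\Delta t)$ converges (unconditionally), and there is a constant $C$ depending only on $\|H_s\|$, $\|\rho_s(0)\|$, $\|W_s\|$, $\bar B$, $\bar B'$ and $T=n\Delta t$ such that $$\|\rho_{s,n}-\rho_s(n\Delta t)\|\le C\,\Delta t .$$ -/

import Mathlib

open MeasureTheory

noncomputable section

namespace OpenDyson

/-- The pairings of `{0, …, k-1}`, encoded as the involutions without fixed points:
`i` is paired with `σ i`. For `k = 0` there is exactly one (the empty pairing), and for odd `k`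
there is none. -/
def pairings (k : ℕ) : Finset (Equiv.Perm (Fin k)) :=
  Finset.univ.filter fun σ => ∀ i, σ (σ i) = i ∧ σ i ≠ i

/-- The sum over all pairings of the times `τ 0, τ 1, …, τ (k-1)` of the product of `B` over the
pairs; in each pair the time that comes first in the sequence is the first argument of `B`. -/
def pairingSum (B : ℝ → ℝ → ℂ) {k : ℕ} (τ : Fin k → ℝ) : ℂ :=
  ∑ σ ∈ pairings k, ∏ i ∈ Finset.univ.filter (fun i => i < σ i), B (τ i) (τ (σ i))

/-- The bath influence functional `𝓛_b(-t_m, …, -t_1; t'_1, …, t'_{m'})`. -/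
def influence (B : ℝ → ℝ → ℂ) {m m' : ℕ} (t : Fin m → ℝ) (t' : Fin m' → ℝ) : ℂ :=
  pairingSum B (Fin.append (fun i => -t i.rev) t')

/-- The simplex `0 < s_1 < s_2 < ⋯ < s_m < t`. -/
def simplex (m : ℕ) (t : ℝ) : Set (Fin m → ℝ) :=
  {s | StrictMono s ∧ ∀ i, s i ∈ Set.Ioo 0 t}

section Operators

variable {E : Type*} [NormedAddCommGroup E] [InnerProductSpace ℂ E] [CompleteSpace E]

/-- The free propagator `exp (-i H t)`. -/
def freeProp (H : E →L[ℂ] E) (t : ℝ) : E →L[ℂ] E :=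
  NormedSpace.exp ((-(Complex.I * (t : ℂ))) • H)

/-- `exp (-i H (t - t_m)) W exp (-i H (t_m - t_{m-1})) W ⋯ W exp (-i H t_1)`. -/
def leftChain (H W : E →L[ℂ] E) : (m : ℕ) → ℝ → (Fin m → ℝ) → (E →L[ℂ] E)
  | 0, t, _ => freeProp H t
  | m + 1, t, s =>
      freeProp H (t - s (Fin.last m)) * W * leftChain H W m (s (Fin.last m)) (Fin.init s)

/-- `exp (i H t'_1) W exp (i H (t'_2 - t'_1)) W ⋯ W exp (i H (t - t'_{m'}))`. -/
def rightChain (H W : E →L[ℂ] E) : (m : ℕ) → ℝ → (Fin m → ℝ) → (E →L[ℂ] E)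
  | 0, t, _ => freeProp H (-t)
  | m + 1, t, s =>
      rightChain H W m (s (Fin.last m)) (Fin.init s) * W * freeProp H (-(t - s (Fin.last m)))

/-- The integrand of the `(m, m')` term of the Dyson series for the reduced density matrix. -/
def dysonIntegrand (H W ρ₀ : E →L[ℂ] E) (B : ℝ → ℝ → ℂ) (t : ℝ) (m m' : ℕ)
    (p : (Fin m → ℝ) × (Fin m' → ℝ)) : E →L[ℂ] E :=
  influence B p.1 p.2 • (leftChain H W m t p.1 * ρ₀ * rightChain H W m' t p.2)

/-- The `(m, m')` term of the Dyson series for the reduced density matrix at time `t`. -/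
def dysonTerm (H W ρ₀ : E →L[ℂ] E) (B : ℝ → ℝ → ℂ) (t : ℝ) (m m' : ℕ) : E →L[ℂ] E :=
  ((-Complex.I) ^ m * Complex.I ^ m') •
    ∫ p in simplex m t ×ˢ simplex m' t, dysonIntegrand H W ρ₀ B t m m' p

/-- The reduced density matrix `ρ_s(t)`. -/
def reducedDensity (H W ρ₀ : E →L[ℂ] E) (B : ℝ → ℝ → ℂ) (t : ℝ) : E →L[ℂ] E :=
  ∑' m : ℕ, ∑' m' : ℕ, dysonTerm H W ρ₀ B t m m'

/-- The one-step operators `𝓟_{s,0} = exp (-i H Δt)` and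
`𝓟_{s,1} = -i Δt exp (-i H Δt / 2) W exp (-i H Δt / 2)`. -/
def stepOp (H W : E →L[ℂ] E) (Δt : ℝ) (j : Fin 2) : E →L[ℂ] E :=
  if j = 0 then freeProp H Δt
  else (-(Complex.I * (Δt : ℂ))) • (freeProp H (Δt / 2) * W * freeProp H (Δt / 2))

/-- The positions of the ones in the sequence `j`, counted from zero. -/
def ones {n : ℕ} (j : Fin n → Fin 2) : Finset (Fin n) :=
  Finset.univ.filter fun k => j k = 1

/-- The midpoints of the time steps in which `j` is one, in increasing order. The step with
zero-based index `k` is `[k Δt, (k + 1) Δt]`. -/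
def midTimes {n : ℕ} (Δt : ℝ) (j : Fin n → Fin 2) (a : Fin (ones j).card) : ℝ :=
  ((((ones j).orderEmbOfFin rfl a : Fin n) : ℕ) + 1 / 2 : ℝ) * Δt

/-- The first-order discrete Dyson approximation `ρ_{s,n}`. -/
def discreteDensity (H W ρ₀ : E →L[ℂ] E) (B : ℝ → ℝ → ℂ) (Δt : ℝ) (n : ℕ) : E →L[ℂ] E :=
  ∑ jm : Fin n → Fin 2, ∑ jp : Fin n → Fin 2,
    influence B (midTimes Δt jm) (midTimes Δt jp) •
      ((List.ofFn fun k => stepOp H W Δt (jm k)).reverse.prod * ρ₀ *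
        (List.ofFn fun k => star (stepOp H W Δt (jp k))).prod)

end Operators

/-- `B` is bounded by `b`, and away from the axes its partial derivatives exist and the sum of
their absolute values is bounded by `b'`. -/
structure IsBoundedCorrelation (B : ℝ → ℝ → ℂ) (b b' : ℝ) : Prop where
  bound : ∀ τ₁ τ₂, ‖B τ₁ τ₂‖ ≤ b
  diff_left : ∀ τ₁ τ₂, τ₁ ≠ 0 → τ₂ ≠ 0 → DifferentiableAt ℝ (fun s => B s τ₂) τ₁
  diff_right : ∀ τ₁ τ₂, τ₁ ≠ 0 → τ₂ ≠ 0 → DifferentiableAt ℝ (fun s => B τ₁ s) τ₂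
  deriv_bound : ∀ τ₁ τ₂, τ₁ ≠ 0 → τ₂ ≠ 0 →
    ‖deriv (fun s => B s τ₂) τ₁‖ + ‖deriv (fun s => B τ₁ s) τ₂‖ ≤ b'

end OpenDyson

end

open OpenDyson

/-! The `(m, m')` part of `ρ_{s,n}` is a midpoint Riemann sum of the `(m, m')` term of the Dyson
series, because a product of step operators telescopes into a chain of free propagators and
couplings at the midpoints of the steps that carry a coupling. For the sup norm, the balls of radius
`Δt / 2` around tuples of distinct midpoints are disjoint, lie in the simplex of ordered times, and
miss only a set of volume `O(Δt)`. On the product of the two simplices no time changes its sign, so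
the possible discontinuity of `B` across the axes is harmless and the integrand is Lipschitz there.
Since the number of pairings of `k` points is at most the square root of `k!`, while the simplices
have volume `T^m / m!` and `T^m' / m'!`, the errors of all terms sum to `O(Δt)`. -/

namespace OpenDyson

open scoped Nat

theorem norm_mul_sub_mul_le {R : Type*} [NonUnitalNormedRing R] (a b c d : R) :
    ‖a * b - c * d‖ ≤ ‖a - c‖ * ‖b‖ + ‖c‖ * ‖b - d‖ := by
  have telescope : a * b - c * d = (a - c) * b + c * (b - d) := by noncomm_ring
  rw [telescope]
  exact (norm_add_le _ _).trans (add_le_add (norm_mul_le _ _) (norm_mul_le _ _))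

section FreePropagator

variable {E : Type*} [NormedAddCommGroup E] [InnerProductSpace ℂ E] [CompleteSpace E]
  {H : E →L[ℂ] E}

theorem freeProp_zero (H : E →L[ℂ] E) : freeProp H 0 = 1 := by
  simp [freeProp]

theorem freeProp_add (H : E →L[ℂ] E) (s t : ℝ) :
    freeProp H (s + t) = freeProp H s * freeProp H t := by
  let _ : NormedAlgebra ℚ (E →L[ℂ] E) := NormedAlgebra.restrictScalars ℚ ℂ (E →L[ℂ] E)
  have generators_commute :
      Commute ((-(Complex.I * (s : ℂ))) • H) ((-(Complex.I * (t : ℂ))) • H) :=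
    ((Commute.refl H).smul_left _).smul_right _
  rw [freeProp, freeProp, freeProp, ← NormedSpace.exp_add_of_commute generators_commute,
    ← add_smul]
  congr 2
  push_cast
  ring

theorem star_freeProp (hH : IsSelfAdjoint H) (t : ℝ) : star (freeProp H t) = freeProp H (-t) := by
  rw [freeProp, freeProp, NormedSpace.star_exp, star_smul, hH.star_eq]
  simp

theorem freeProp_mem_unitary (hH : IsSelfAdjoint H) (t : ℝ) :
    freeProp H t ∈ unitary (E →L[ℂ] E) := by
  rw [Unitary.mem_iff, star_freeProp hH, ← freeProp_add, ← freeProp_add, neg_add_cancel,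
    add_neg_cancel, freeProp_zero]
  exact ⟨rfl, rfl⟩

theorem norm_freeProp_mul (hH : IsSelfAdjoint H) (t : ℝ) (A : E →L[ℂ] E) :
    ‖freeProp H t * A‖ = ‖A‖ :=
  CStarRing.norm_mem_unitary_mul A (freeProp_mem_unitary hH t)

theorem hasDerivAt_freeProp (H : E →L[ℂ] E) (t : ℝ) :
    HasDerivAt (freeProp H) (freeProp H t * ((-Complex.I) • H)) t := by
  have freeProp_eq_exp (u : ℝ) : freeProp H u = NormedSpace.exp (u • ((-Complex.I) • H)) := by
    rw [freeProp, ← Complex.coe_smul, smul_smul, mul_neg, mul_comm]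
  rw [funext freeProp_eq_exp]
  exact hasDerivAt_exp_smul_const (𝕂 := ℝ) ((-Complex.I) • H) t

theorem norm_freeProp_sub_le (hH : IsSelfAdjoint H) (s t : ℝ) :
    ‖freeProp H s - freeProp H t‖ ≤ ‖H‖ * |s - t| := by
  refine Convex.norm_image_sub_le_of_norm_hasDerivWithin_le (s := Set.univ)
    (fun u _ => (hasDerivAt_freeProp H u).hasDerivWithinAt) (fun u _ => ?_) convex_univ
    (Set.mem_univ t) (Set.mem_univ s)
  rw [norm_freeProp_mul hH, norm_smul, norm_neg, Complex.norm_I, one_mul]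

theorem norm_freeProp_mul_sub_le (hH : IsSelfAdjoint H) (s t : ℝ) (A A' : E →L[ℂ] E) :
    ‖freeProp H s * A - freeProp H t * A'‖ ≤ ‖H‖ * |s - t| * ‖A‖ + ‖A - A'‖ :=
  calc ‖freeProp H s * A - freeProp H t * A'‖
    _ = ‖(freeProp H s - freeProp H t) * A + freeProp H t * (A - A')‖ := by
      congr 1
      noncomm_ring
    _ ≤ ‖(freeProp H s - freeProp H t) * A‖ + ‖freeProp H t * (A - A')‖ := norm_add_le _ _
    _ ≤ ‖H‖ * |s - t| * ‖A‖ + ‖A - A'‖ := by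
      rw [norm_freeProp_mul hH]
      gcongr
      exact (norm_mul_le _ _).trans (by gcongr; exact norm_freeProp_sub_le hH s t)

end FreePropagator

section Chains

variable {E : Type*} [NormedAddCommGroup E] [InnerProductSpace ℂ E] [CompleteSpace E]
  {H W : E →L[ℂ] E}

theorem freeProp_mul_leftChain (H W : E →L[ℂ] E) (m : ℕ) (u t : ℝ) (s : Fin m → ℝ) :
    freeProp H u * leftChain H W m t s = leftChain H W m (u + t) s := by
  cases m with
  | zero => exact (freeProp_add H u t).symm
  | succ m => simp only [leftChain, ← mul_assoc, ← freeProp_add, add_sub_assoc]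

theorem rightChain_eq_star_leftChain (hH : IsSelfAdjoint H) (W : E →L[ℂ] E) (m : ℕ) (t : ℝ)
    (s : Fin m → ℝ) : rightChain H W m t s = star (leftChain H (star W) m t s) := by
  induction m generalizing t with
  | zero => exact (star_freeProp hH t).symm
  | succ m ih =>
    simp only [rightChain, leftChain, star_mul, star_freeProp hH, star_star, ih, mul_assoc]

theorem norm_leftChain_le (hH : IsSelfAdjoint H) (W : E →L[ℂ] E) (m : ℕ) (t : ℝ)
    (s : Fin m → ℝ) : ‖leftChain H W m t s‖ ≤ ‖W‖ ^ m := by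
  induction m generalizing t with
  | zero =>
    rw [leftChain, pow_zero, ← mul_one (freeProp H t), norm_freeProp_mul hH]
    exact ContinuousLinearMap.norm_id_le
  | succ m ih =>
    rw [leftChain, mul_assoc, norm_freeProp_mul hH, pow_succ']
    exact (norm_mul_le _ _).trans (mul_le_mul_of_nonneg_left (ih _ _) (norm_nonneg W))

theorem norm_leftChain_sub_le (hH : IsSelfAdjoint H) (W : E →L[ℂ] E) (m : ℕ) (t t' : ℝ)
    (s s' : Fin m → ℝ) :
    ‖leftChain H W m t s - leftChain H W m t' s'‖ ≤
      ‖W‖ ^ m * ‖H‖ * (|t - t'| + 2 * m * dist s s') := by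
  induction m generalizing t t' with
  | zero => simpa [leftChain] using norm_freeProp_sub_le hH t t'
  | succ m ih =>
    set a := s (Fin.last m)
    set a' := s' (Fin.last m)
    set L := leftChain H W m a (Fin.init s)
    set L' := leftChain H W m a' (Fin.init s')
    have dist_last : |a - a'| ≤ dist s s' := dist_le_pi_dist s s' (Fin.last m)
    have dist_init : dist (Fin.init s) (Fin.init s') ≤ dist s s' :=
      (dist_pi_le_iff dist_nonneg).2 fun i => dist_le_pi_dist s s' i.castSucc
    have duration_sub_le : |(t - a) - (t' - a')| ≤ |t - t'| + dist s s' := by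
      rw [sub_sub_sub_comm]
      exact (abs_sub _ _).trans (by gcongr)
    calc ‖freeProp H (t - a) * W * L - freeProp H (t' - a') * W * L'‖
      _ ≤ ‖H‖ * |(t - a) - (t' - a')| * ‖W * L‖ + ‖W * L - W * L'‖ := by
        rw [mul_assoc, mul_assoc]
        exact norm_freeProp_mul_sub_le hH _ _ _ _
      _ ≤ ‖H‖ * (|t - t'| + dist s s') * (‖W‖ * ‖W‖ ^ m)
          + ‖W‖ * (‖W‖ ^ m * ‖H‖ * (dist s s' + 2 * m * dist s s')) := by
        rw [← mul_sub]
        gcongr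
        · exact (norm_mul_le _ _).trans (by gcongr; exact norm_leftChain_le hH W m _ _)
        · exact (norm_mul_le _ _).trans (by gcongr; exact (ih _ _ _ _).trans (by gcongr))
      _ = ‖W‖ ^ (m + 1) * ‖H‖ * (|t - t'| + 2 * (m + 1 : ℕ) * dist s s') := by
        push_cast
        ring

theorem norm_rightChain_le (hH : IsSelfAdjoint H) (W : E →L[ℂ] E) (m : ℕ) (t : ℝ)
    (s : Fin m → ℝ) : ‖rightChain H W m t s‖ ≤ ‖W‖ ^ m := by
  rw [rightChain_eq_star_leftChain hH, norm_star, ← norm_star W]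
  exact norm_leftChain_le hH (star W) m t s

theorem norm_rightChain_sub_le (hH : IsSelfAdjoint H) (W : E →L[ℂ] E) (m : ℕ) (t t' : ℝ)
    (s s' : Fin m → ℝ) :
    ‖rightChain H W m t s - rightChain H W m t' s'‖ ≤
      ‖W‖ ^ m * ‖H‖ * (|t - t'| + 2 * m * dist s s') := by
  rw [rightChain_eq_star_leftChain hH, rightChain_eq_star_leftChain hH, ← star_sub, norm_star,
    ← norm_star W]
  exact norm_leftChain_sub_le hH (star W) m t t' s s'

theorem norm_leftChain_mul_mul_rightChain_le (hH : IsSelfAdjoint H) (W ρ₀ : E →L[ℂ] E) (t : ℝ)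
    {m m' : ℕ} (s : Fin m → ℝ) (s' : Fin m' → ℝ) :
    ‖leftChain H W m t s * ρ₀ * rightChain H W m' t s'‖ ≤ ‖W‖ ^ (m + m') * ‖ρ₀‖ :=
  calc ‖leftChain H W m t s * ρ₀ * rightChain H W m' t s'‖
    _ ≤ ‖leftChain H W m t s‖ * ‖ρ₀‖ * ‖rightChain H W m' t s'‖ := norm_mul₃_le
    _ ≤ ‖W‖ ^ m * ‖ρ₀‖ * ‖W‖ ^ m' := by
      gcongr
      · exact norm_leftChain_le hH W m t s
      · exact norm_rightChain_le hH W m' t s'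
    _ = ‖W‖ ^ (m + m') * ‖ρ₀‖ := by ring

theorem norm_leftChain_mul_mul_rightChain_sub_le (hH : IsSelfAdjoint H) (W ρ₀ : E →L[ℂ] E)
    (t : ℝ) {m m' : ℕ} (p q : (Fin m → ℝ) × (Fin m' → ℝ)) :
    ‖leftChain H W m t p.1 * ρ₀ * rightChain H W m' t p.2 -
        leftChain H W m t q.1 * ρ₀ * rightChain H W m' t q.2‖ ≤
      ‖W‖ ^ (m + m') * ‖ρ₀‖ * (2 * ((m + m' : ℕ) * ‖H‖) * dist p q) := by
  set L := leftChain H W m t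
  set R := rightChain H W m' t
  have left_sub_le : ‖L p.1 - L q.1‖ ≤ ‖W‖ ^ m * ‖H‖ * (2 * m * dist p q) := by
    have sub_le := norm_leftChain_sub_le hH W m t t p.1 q.1
    rw [sub_self, abs_zero, zero_add] at sub_le
    exact sub_le.trans (by gcongr; exact le_max_left _ _)
  have right_sub_le : ‖R p.2 - R q.2‖ ≤ ‖W‖ ^ m' * ‖H‖ * (2 * m' * dist p q) := by
    have sub_le := norm_rightChain_sub_le hH W m' t t p.2 q.2
    rw [sub_self, abs_zero, zero_add] at sub_le
    exact sub_le.trans (by gcongr; exact le_max_right _ _)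
  calc ‖L p.1 * ρ₀ * R p.2 - L q.1 * ρ₀ * R q.2‖
    _ ≤ ‖L p.1 * ρ₀ - L q.1 * ρ₀‖ * ‖R p.2‖ + ‖L q.1 * ρ₀‖ * ‖R p.2 - R q.2‖ :=
      norm_mul_sub_mul_le _ _ _ _
    _ ≤ ‖L p.1 - L q.1‖ * ‖ρ₀‖ * ‖R p.2‖ + ‖L q.1‖ * ‖ρ₀‖ * ‖R p.2 - R q.2‖ := by
      rw [← sub_mul]
      gcongr <;> exact norm_mul_le _ _
    _ ≤ ‖W‖ ^ m * ‖H‖ * (2 * m * dist p q) * ‖ρ₀‖ * ‖W‖ ^ m'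
        + ‖W‖ ^ m * ‖ρ₀‖ * (‖W‖ ^ m' * ‖H‖ * (2 * m' * dist p q)) := by
      gcongr
      · exact norm_rightChain_le hH W m' t _
      · exact norm_leftChain_le hH W m t _
    _ = ‖W‖ ^ (m + m') * ‖ρ₀‖ * (2 * ((m + m' : ℕ) * ‖H‖) * dist p q) := by
      push_cast
      ring

end Chains

/-- The midpoint of the time step with zero-based index `k`, as in `midTimes`. -/
noncomputable def stepMidpoint (Δt : ℝ) (k : ℕ) : ℝ :=
  (k + 1 / 2) * Δt

theorem isGreatest_range_last {α : Type*} [Preorder α] {m : ℕ} {κ : Fin (m + 1) → α}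
    (hκ : Monotone κ) : IsGreatest (Set.range κ) (κ (Fin.last m)) :=
  ⟨Set.mem_range_self _, Set.forall_mem_range.2 fun a => hκ (Fin.le_last a)⟩

theorem range_comp_castSucc {α : Type*} [Preorder α] {m : ℕ} {κ : Fin (m + 1) → α}
    (hκ : StrictMono κ) :
    Set.range (fun a : Fin m => κ a.castSucc) = Set.range κ ∩ Set.Iio (κ (Fin.last m)) := by
  ext k
  constructor
  · rintro ⟨a, rfl⟩
    exact ⟨Set.mem_range_self _, hκ (Fin.castSucc_lt_last a)⟩
  · rintro ⟨⟨a, rfl⟩, ha⟩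
    obtain ⟨a, rfl⟩ | rfl := a.eq_castSucc_or_eq_last
    · exact Set.mem_range_self a
    · exact absurd ha (lt_irrefl _)

section StepProducts

variable {E : Type*} [NormedAddCommGroup E] [InnerProductSpace ℂ E] [CompleteSpace E]
  {H W : E →L[ℂ] E}

theorem stepOp_zero_mul_leftChain (H W : E →L[ℂ] E) (Δt : ℝ) (m : ℕ) (t : ℝ) (s : Fin m → ℝ) :
    stepOp H W Δt 0 * leftChain H W m t s = leftChain H W m (Δt + t) s :=
  freeProp_mul_leftChain H W m Δt t s

theorem stepOp_one_mul_leftChain (H W : E →L[ℂ] E) (Δt : ℝ) (m : ℕ) {t : ℝ}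
    {s : Fin (m + 1) → ℝ} (hs : s (Fin.last m) = Δt / 2 + t) :
    stepOp H W Δt 1 * leftChain H W m t (Fin.init s) =
      (-(Complex.I * Δt)) • leftChain H W (m + 1) (Δt + t) s := by
  have half_step : Δt + t - (Δt / 2 + t) = Δt / 2 := by ring
  simp only [stepOp, one_ne_zero, if_false, leftChain, hs, half_step, smul_mul_assoc, mul_assoc,
    freeProp_mul_leftChain]

theorem prod_stepOp_eq_leftChain (H W : E →L[ℂ] E) (Δt : ℝ) (j : ℕ → Fin 2) (n : ℕ) {m : ℕ}
    {κ : Fin m → ℕ} (hκ : StrictMono κ) (range_κ : Set.range κ = {k | k < n ∧ j k = 1}) :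
    (List.ofFn fun k : Fin n => stepOp H W Δt (j k)).reverse.prod =
      (-(Complex.I * Δt)) ^ m •
        leftChain H W m (n * Δt) (fun a => stepMidpoint Δt (κ a)) := by
  induction n generalizing m with
  | zero =>
    have range_empty : Set.range κ = ∅ := by simp [range_κ]
    obtain rfl : m = 0 := by
      simpa using Fintype.card_eq_zero_iff.2 (Set.range_eq_empty_iff.1 range_empty)
    simp [leftChain, freeProp_zero]
  | succ n ih =>
    have next_time : ((n + 1 : ℕ) : ℝ) * Δt = Δt + n * Δt := by push_cast; ring
    rw [List.ofFn_succ', List.concat_eq_append, List.reverse_append, List.prod_append]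
    simp only [List.reverse_singleton, List.prod_singleton, Fin.val_castSucc, Fin.val_last]
    rw [next_time]
    obtain hj | hj : j n = 0 ∨ j n = 1 := by lia
    · rw [ih hκ, hj, mul_smul_comm, stepOp_zero_mul_leftChain]
      rw [range_κ]
      ext k
      simp only [Set.mem_ofPred_eq, Nat.lt_succ_iff_lt_or_eq]
      grind
    · have greatest : IsGreatest (Set.range κ) n := by
        rw [range_κ]
        exact ⟨⟨n.lt_succ_self, hj⟩, fun k hk => Nat.lt_succ_iff.1 hk.1⟩
      obtain ⟨m, rfl⟩ : ∃ l, m = l + 1 := by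
        obtain ⟨a, -⟩ := greatest.1
        exact ⟨m - 1, (Nat.succ_pred_eq_of_pos a.pos).symm⟩
      have last_eq : κ (Fin.last m) = n := (isGreatest_range_last hκ.monotone).unique greatest
      have last_midpoint : stepMidpoint Δt (κ (Fin.last m)) = Δt / 2 + n * Δt := by
        rw [last_eq, stepMidpoint]
        ring
      rw [ih (hκ.comp Fin.strictMono_castSucc), hj, mul_smul_comm, pow_succ, mul_smul]
      · congr 1
        exact stepOp_one_mul_leftChain H W Δt m (s := fun a => stepMidpoint Δt (κ a)) last_midpoint
      · refine (range_comp_castSucc hκ).trans ?_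
        rw [range_κ, last_eq]
        ext k
        simp only [Set.mem_inter_iff, Set.mem_ofPred_eq, Set.mem_Iio]
        grind

theorem prod_stepOp_eq_leftChain_midTimes (H W : E →L[ℂ] E) (Δt : ℝ) {n : ℕ} (j : Fin n → Fin 2) :
    (List.ofFn fun k => stepOp H W Δt (j k)).reverse.prod =
      (-(Complex.I * Δt)) ^ (ones j).card •
        leftChain H W (ones j).card (n * Δt) (midTimes Δt j) := by
  set j₀ : ℕ → Fin 2 := Function.extend Fin.val j 0
  have j₀_val (k : Fin n) : j₀ k = j k := Fin.val_injective.extend_apply j 0 k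
  have range_ones : Set.range (fun a => ((ones j).orderEmbOfFin rfl a : ℕ)) =
      {k | k < n ∧ j₀ k = 1} := by
    rw [Set.range_comp' Fin.val, Finset.range_orderEmbOfFin]
    ext k
    constructor
    · rintro ⟨k, hk, rfl⟩
      exact ⟨k.is_lt, (j₀_val k).trans (by simpa [ones] using hk)⟩
    · rintro ⟨hkn, hk⟩
      exact ⟨⟨k, hkn⟩, by simpa [ones] using (j₀_val ⟨k, hkn⟩).symm.trans hk, rfl⟩
  simp only [← j₀_val]
  exact prod_stepOp_eq_leftChain H W Δt j₀ n ((ones j).orderEmbOfFin rfl).strictMono range_ones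

theorem star_prod_reverse {R : Type*} [Monoid R] [StarMul R] (l : List R) :
    star l.reverse.prod = (l.map star).prod := by
  induction l with
  | nil => simp
  | cons a l ih => simp [ih]

theorem prod_star_stepOp_eq_rightChain_midTimes (hH : IsSelfAdjoint H) (hW : IsSelfAdjoint W)
    (Δt : ℝ) {n : ℕ} (j : Fin n → Fin 2) :
    (List.ofFn fun k => star (stepOp H W Δt (j k))).prod =
      (Complex.I * Δt) ^ (ones j).card •
        rightChain H W (ones j).card (n * Δt) (midTimes Δt j) :=
  calc (List.ofFn fun k => star (stepOp H W Δt (j k))).prod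
    _ = star (List.ofFn fun k => stepOp H W Δt (j k)).reverse.prod := by
      rw [star_prod_reverse, List.map_ofFn]
      rfl
    _ = (Complex.I * Δt) ^ (ones j).card •
        rightChain H W (ones j).card (n * Δt) (midTimes Δt j) := by
      rw [prod_stepOp_eq_leftChain_midTimes, star_smul, rightChain_eq_star_leftChain hH,
        hW.star_eq]
      simp

end StepProducts

section Pairings

theorem mem_pairings_iff {k : ℕ} {σ : Equiv.Perm (Fin k)} :
    σ ∈ pairings k ↔ σ ^ 2 = 1 ∧ σ.support = Finset.univ := by
  simp only [pairings, Finset.mem_filter, Finset.mem_univ, true_and, forall_and, Equiv.ext_iff,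
    sq, Equiv.Perm.mul_apply, Equiv.Perm.one_apply, Finset.eq_univ_iff_forall,
    Equiv.Perm.mem_support]

theorem pairings_eq_empty_of_odd {k : ℕ} (hk : Odd k) : pairings k = ∅ := by
  refine Finset.eq_empty_of_forall_notMem fun σ hσ => Nat.not_even_iff_odd.2 hk ?_
  obtain ⟨sq_eq_one, support_eq⟩ := mem_pairings_iff.1 hσ
  have two_dvd := Equiv.Perm.two_dvd_card_support sq_eq_one
  rw [support_eq, Finset.card_fin] at two_dvd
  exact even_iff_two_dvd.2 two_dvd

theorem mem_pairings_two_mul_iff {p : ℕ} {σ : Equiv.Perm (Fin (2 * p))} :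
    σ ∈ pairings (2 * p) ↔ σ.cycleType = Multiset.replicate p 2 := by
  rw [mem_pairings_iff, Equiv.Perm.pow_prime_eq_one_iff, ← Finset.card_eq_iff_eq_univ,
    Fintype.card_fin, ← Equiv.Perm.sum_cycleType]
  constructor
  · rintro ⟨all_two, sum_eq⟩
    rw [Multiset.eq_replicate_card.2 all_two, Multiset.sum_replicate, smul_eq_mul] at sum_eq
    exact Multiset.eq_replicate.2 ⟨by lia, all_two⟩
  · intro cycleType_eq
    rw [cycleType_eq, Multiset.sum_replicate, smul_eq_mul, mul_comm]
    exact ⟨fun c hc => Multiset.eq_of_mem_replicate hc, rfl⟩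

theorem card_pairings_two_mul_mul_doubleFactorial (p : ℕ) :
    (pairings (2 * p)).card * (2 * p)‼ = (2 * p)! := by
  have pairings_eq : pairings (2 * p) =
      Finset.univ.filter fun σ => σ.cycleType = Multiset.replicate p 2 := by
    ext σ
    simp [mem_pairings_two_mul_iff]
  have prod_factorial_count :
      ∏ c ∈ (Multiset.replicate p 2).toFinset, ((Multiset.replicate p 2).count c)! = p ! := by
    rcases p with _ | p
    · rfl
    · rw [Multiset.toFinset_replicate, if_neg p.succ_ne_zero, Finset.prod_singleton,
        Multiset.count_replicate_self]
  have count := Equiv.Perm.card_of_cycleType_mul_eq (Fin (2 * p)) (Multiset.replicate p 2)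
  rw [← pairings_eq, prod_factorial_count, Multiset.sum_replicate, Multiset.prod_replicate,
    Fintype.card_fin, smul_eq_mul, mul_comm p 2, Nat.sub_self, Nat.factorial_zero, one_mul,
    if_pos ⟨le_rfl, fun c hc => (Multiset.eq_of_mem_replicate hc).ge⟩] at count
  rw [Nat.doubleFactorial_two_mul, count]

theorem doubleFactorial_le_succ : ∀ n : ℕ, n‼ ≤ (n + 1)‼
  | 0 => le_rfl
  | 1 => one_le_two
  | n + 2 => Nat.mul_le_mul (Nat.le_succ _) (doubleFactorial_le_succ n)

theorem factorial_le_doubleFactorial_sq (n : ℕ) : n ! ≤ n‼ ^ 2 := by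
  cases n with
  | zero => rfl
  | succ n =>
    rw [Nat.factorial_eq_mul_doubleFactorial, sq]
    exact Nat.mul_le_mul_left _ (doubleFactorial_le_succ n)

theorem card_pairings_sq_le_factorial (k : ℕ) : (pairings k).card ^ 2 ≤ k ! := by
  rcases k.even_or_odd' with ⟨p, rfl | rfl⟩
  · refine Nat.le_of_mul_le_mul_right ?_ (pow_pos (Nat.doubleFactorial_pos (2 * p)) 2)
    rw [← mul_pow, card_pairings_two_mul_mul_doubleFactorial, sq (2 * p)!]
    exact Nat.mul_le_mul_left _ (factorial_le_doubleFactorial_sq (2 * p))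
  · simp [pairings_eq_empty_of_odd ⟨p, rfl⟩]

theorem card_pairings_add_sq_le (m m' : ℕ) :
    (pairings (m + m')).card ^ 2 ≤ 2 ^ (m + m') * (m ! * m' !) :=
  calc (pairings (m + m')).card ^ 2
    _ ≤ (m + m')! := card_pairings_sq_le_factorial (m + m')
    _ = (m + m').choose m * (m ! * m' !) := by
      rw [← Nat.add_choose_mul_factorial_mul_factorial m m', Nat.choose_symm_add, mul_assoc]
    _ ≤ 2 ^ (m + m') * (m ! * m' !) := Nat.mul_le_mul_right _ (Nat.choose_le_two_pow _ _)

end Pairings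

section FiniteProducts

variable {ι R : Type*} [NormedCommRing R] [NormOneClass R]

theorem norm_prod_le_pow_card (s : Finset ι) (f : ι → R) {β : ℝ} (hf : ∀ i ∈ s, ‖f i‖ ≤ β) :
    ‖∏ i ∈ s, f i‖ ≤ β ^ s.card :=
  (Finset.norm_prod_le s f).trans
    ((Finset.prod_le_prod (fun i _ => norm_nonneg (f i)) hf).trans_eq (Finset.prod_const β))

theorem norm_prod_sub_prod_le (s : Finset ι) (f g : ι → R) {β η : ℝ} (hβ : 1 ≤ β)
    (hf : ∀ i ∈ s, ‖f i‖ ≤ β) (hg : ∀ i ∈ s, ‖g i‖ ≤ β) (hfg : ∀ i ∈ s, ‖f i - g i‖ ≤ η) :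
    ‖∏ i ∈ s, f i - ∏ i ∈ s, g i‖ ≤ s.card * β ^ s.card * η := by
  induction s using Finset.cons_induction with
  | empty => simp
  | cons a s ha ih =>
    rw [Finset.forall_mem_cons] at hf hg hfg
    rw [Finset.prod_cons, Finset.prod_cons, Finset.card_cons]
    have η_nonneg : 0 ≤ η := (norm_nonneg _).trans hfg.1
    calc ‖f a * ∏ i ∈ s, f i - g a * ∏ i ∈ s, g i‖
      _ ≤ ‖f a - g a‖ * ‖∏ i ∈ s, f i‖ + ‖g a‖ * ‖∏ i ∈ s, f i - ∏ i ∈ s, g i‖ :=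
        norm_mul_sub_mul_le _ _ _ _
      _ ≤ η * β ^ s.card + β * (s.card * β ^ s.card * η) := by
        gcongr
        · exact hfg.1
        · exact norm_prod_le_pow_card s f hf.2
        · exact hg.1
        · exact ih hf.2 hg.2 hfg.2
      _ ≤ η * β ^ (s.card + 1) + β * (s.card * β ^ s.card * η) := by
        gcongr
        exact Nat.le_succ _
      _ = (s.card + 1 : ℕ) * β ^ (s.card + 1) * η := by
        push_cast
        ring

end FiniteProducts

section Influence

theorem norm_sub_le_of_mul_pos {F : Type*} [NormedAddCommGroup F] [NormedSpace ℝ F] {f : ℝ → F}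
    {c u v : ℝ} (hd : ∀ w ≠ 0, DifferentiableAt ℝ f w) (hc : ∀ w ≠ 0, ‖deriv f w‖ ≤ c)
    (huv : 0 < u * v) : ‖f u - f v‖ ≤ c * |u - v| := by
  rcases pos_and_pos_or_neg_and_neg_of_mul_pos huv with ⟨hu, hv⟩ | ⟨hu, hv⟩
  · exact (convex_Ioi (0 : ℝ)).norm_image_sub_le_of_norm_deriv_le
      (fun w hw => hd w (ne_of_gt hw)) (fun w hw => hc w (ne_of_gt hw)) hv hu
  · exact (convex_Iio (0 : ℝ)).norm_image_sub_le_of_norm_deriv_le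
      (fun w hw => hd w (ne_of_lt hw)) (fun w hw => hc w (ne_of_lt hw)) hv hu

variable {B : ℝ → ℝ → ℂ} {b b' : ℝ}

theorem IsBoundedCorrelation.nonneg (hB : IsBoundedCorrelation B b b') : 0 ≤ b :=
  (norm_nonneg _).trans (hB.bound 0 0)

theorem IsBoundedCorrelation.deriv_nonneg (hB : IsBoundedCorrelation B b b') : 0 ≤ b' :=
  le_trans (by positivity) (hB.deriv_bound 1 1 one_ne_zero one_ne_zero)

theorem IsBoundedCorrelation.norm_sub_le (hB : IsBoundedCorrelation B b b') {x x' y y' : ℝ}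
    (hx : 0 < x * x') (hy : 0 < y * y') :
    ‖B x y - B x' y'‖ ≤ b' * (|x - x'| + |y - y'|) := by
  have x'_ne : x' ≠ 0 := right_ne_zero_of_mul hx.ne'
  have y_ne : y ≠ 0 := left_ne_zero_of_mul hy.ne'
  have left_le : ‖B x y - B x' y‖ ≤ b' * |x - x'| :=
    norm_sub_le_of_mul_pos (f := fun s => B s y) (fun w hw => hB.diff_left w y hw y_ne)
      (fun w hw => le_of_add_le_of_nonneg_left (hB.deriv_bound w y hw y_ne) (norm_nonneg _)) hx
  have right_le : ‖B x' y - B x' y'‖ ≤ b' * |y - y'| :=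
    norm_sub_le_of_mul_pos (fun w hw => hB.diff_right x' w x'_ne hw)
      (fun w hw => le_of_add_le_of_nonneg_right (hB.deriv_bound x' w x'_ne hw) (norm_nonneg _)) hy
  rw [mul_add]
  exact (norm_sub_le_norm_sub_add_norm_sub _ _ _).trans (add_le_add left_le right_le)

theorem card_filter_lt_le {k : ℕ} (σ : Equiv.Perm (Fin k)) :
    (Finset.univ.filter fun i => i < σ i).card ≤ k :=
  (Finset.card_filter_le _ _).trans_eq (Finset.card_fin k)

theorem norm_pairingSum_le (hB : IsBoundedCorrelation B b b') {k : ℕ} (τ : Fin k → ℝ) :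
    ‖pairingSum B τ‖ ≤ (pairings k).card * (1 + b) ^ k := by
  have one_le : 1 ≤ 1 + b := le_add_of_nonneg_right hB.nonneg
  rw [← nsmul_eq_mul, pairingSum]
  refine (norm_sum_le_of_le _ fun σ _ => ?_).trans_eq (Finset.sum_const _)
  calc ‖∏ i ∈ Finset.univ.filter (fun i => i < σ i), B (τ i) (τ (σ i))‖
    _ ≤ (1 + b) ^ (Finset.univ.filter fun i => i < σ i).card :=
      norm_prod_le_pow_card _ _ fun i _ =>
        (hB.bound _ _).trans (le_add_of_nonneg_left zero_le_one)
    _ ≤ (1 + b) ^ k := pow_le_pow_right₀ one_le (card_filter_lt_le σ)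

theorem norm_pairingSum_sub_le (hB : IsBoundedCorrelation B b b') {k : ℕ} {τ τ' : Fin k → ℝ}
    (same_sign : ∀ i, 0 < τ i * τ' i) :
    ‖pairingSum B τ - pairingSum B τ'‖ ≤
      (pairings k).card * (k * (1 + b) ^ k * (2 * b' * dist τ τ')) := by
  have one_le : 1 ≤ 1 + b := le_add_of_nonneg_right hB.nonneg
  have b'_nonneg := hB.deriv_nonneg
  have norm_B_le (x y : ℝ) : ‖B x y‖ ≤ 1 + b :=
    (hB.bound x y).trans (le_add_of_nonneg_left zero_le_one)
  have norm_B_sub_le (i j : Fin k) :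
      ‖B (τ i) (τ j) - B (τ' i) (τ' j)‖ ≤ 2 * b' * dist τ τ' :=
    calc ‖B (τ i) (τ j) - B (τ' i) (τ' j)‖
      _ ≤ b' * (dist (τ i) (τ' i) + dist (τ j) (τ' j)) :=
        hB.norm_sub_le (same_sign i) (same_sign j)
      _ ≤ b' * (dist τ τ' + dist τ τ') := by gcongr <;> exact dist_le_pi_dist τ τ' _
      _ = 2 * b' * dist τ τ' := by ring
  rw [← nsmul_eq_mul, pairingSum, pairingSum, ← Finset.sum_sub_distrib]
  refine (norm_sum_le_of_le _ fun σ _ => ?_).trans_eq (Finset.sum_const _)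
  refine (norm_prod_sub_prod_le _ _ _ one_le (fun i _ => norm_B_le _ _)
    (fun i _ => norm_B_le _ _) fun i _ => norm_B_sub_le i (σ i)).trans ?_
  have card_le := card_filter_lt_le σ
  gcongr

theorem norm_influence_le (hB : IsBoundedCorrelation B b b') {m m' : ℕ} (s : Fin m → ℝ)
    (s' : Fin m' → ℝ) :
    ‖influence B s s'‖ ≤ (pairings (m + m')).card * (1 + b) ^ (m + m') :=
  norm_pairingSum_le hB _

theorem norm_influence_sub_le (hB : IsBoundedCorrelation B b b') {m m' : ℕ}
    {p q : (Fin m → ℝ) × (Fin m' → ℝ)} (hp₁ : ∀ i, 0 < p.1 i) (hp₂ : ∀ i, 0 < p.2 i)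
    (hq₁ : ∀ i, 0 < q.1 i) (hq₂ : ∀ i, 0 < q.2 i) :
    ‖influence B p.1 p.2 - influence B q.1 q.2‖ ≤
      (pairings (m + m')).card *
        ((m + m' : ℕ) * (1 + b) ^ (m + m') * (2 * b' * dist p q)) := by
  have b_nonneg := hB.nonneg
  have b'_nonneg := hB.deriv_nonneg
  have dist_append_le : dist (Fin.append (fun i => -p.1 i.rev) p.2)
      (Fin.append (fun i => -q.1 i.rev) q.2) ≤ dist p q := by
    refine (dist_pi_le_iff dist_nonneg).2 (Fin.addCases (fun i => ?_) fun i => ?_)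
    · rw [Fin.append_left, Fin.append_left, dist_neg_neg]
      exact (dist_le_pi_dist p.1 q.1 i.rev).trans (le_max_left _ _)
    · rw [Fin.append_right, Fin.append_right]
      exact (dist_le_pi_dist p.2 q.2 i).trans (le_max_right _ _)
  refine (norm_pairingSum_sub_le hB (Fin.addCases (fun i => ?_) fun i => ?_)).trans (by gcongr)
  · simpa using mul_pos (hp₁ i.rev) (hq₁ i.rev)
  · simpa using mul_pos (hp₂ i) (hq₂ i)

end Influence

section Simplex

theorem measurableSet_simplex (m : ℕ) (t : ℝ) : MeasurableSet (simplex m t) := by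
  have simplex_eq : simplex m t =
      (⋂ i, ⋂ j, ⋂ _ : i < j, {s : Fin m → ℝ | s i < s j}) ∩
        ⋂ i, {s : Fin m → ℝ | s i ∈ Set.Ioo 0 t} := by
    ext s
    simp [simplex, StrictMono]
  rw [simplex_eq]
  measurability

theorem simplex_subset_pi_Ioo (m : ℕ) (t : ℝ) :
    simplex m t ⊆ Set.univ.pi fun _ => Set.Ioo 0 t :=
  fun _ hs i _ => hs.2 i

theorem volume_pi_Ioo_lt_top {ι : Type*} [Fintype ι] (a b : ι → ℝ) :
    volume (Set.univ.pi fun i => Set.Ioo (a i) (b i)) < ⊤ :=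
  (Bornology.IsBounded.pi fun i => Metric.isBounded_Ioo (a i) (b i)).measure_lt_top

theorem volume_simplex_lt_top (m : ℕ) (t : ℝ) : volume (simplex m t) < ⊤ :=
  (measure_mono (simplex_subset_pi_Ioo m t)).trans_lt (volume_pi_Ioo_lt_top _ _)

theorem measurePreserving_comp_perm {ι α : Type*} [Fintype ι] [MeasureSpace α]
    [SigmaFinite (volume : Measure α)] (σ : Equiv.Perm ι) :
    MeasurePreserving (fun s : ι → α => s ∘ σ) volume volume := by
  convert volume_measurePreserving_piCongrLeft (fun _ : ι => α) σ.symm using 1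
  funext s i
  obtain ⟨i, rfl⟩ := σ.symm.surjective i
  rw [MeasurableEquiv.coe_piCongrLeft, Equiv.piCongrLeft_apply_apply, Function.comp_apply,
    Equiv.apply_symm_apply]

theorem perm_eq_of_strictMono_comp {m : ℕ} {α : Type*} [LinearOrder α] {s : Fin m → α}
    {σ τ : Equiv.Perm (Fin m)} (hσ : StrictMono (s ∘ σ)) (hτ : StrictMono (s ∘ τ)) : σ = τ := by
  have comp_eq : s ∘ σ = s ∘ τ := by
    rw [← StrictMono.range_inj hσ hτ, σ.surjective.range_comp, τ.surjective.range_comp]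
  have s_injective : Function.Injective s :=
    (Function.Injective.of_comp_iff' s σ.bijective).1 hσ.injective
  exact Equiv.ext fun i => s_injective (congrFun comp_eq i)

theorem measureReal_simplex_le (m : ℕ) {t : ℝ} (ht : 0 ≤ t) :
    volume.real (simplex m t) ≤ t ^ m / m ! := by
  let copy (σ : Equiv.Perm (Fin m)) : Set (Fin m → ℝ) := (fun s => s ∘ σ) ⁻¹' simplex m t
  have measurableSet_copy (σ) : MeasurableSet (copy σ) :=
    (measurePreserving_comp_perm σ).measurable (measurableSet_simplex m t)
  have volume_copy (σ) : volume.real (copy σ) = volume.real (simplex m t) :=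
    (measurePreserving_comp_perm σ).measureReal_preimage
      (measurableSet_simplex m t).nullMeasurableSet
  have disjoint_copies : Pairwise (Function.onFun Disjoint copy) := fun σ τ hστ =>
    Set.disjoint_left.2 fun _ hσ hτ => hστ (perm_eq_of_strictMono_comp hσ.1 hτ.1)
  have copies_subset : (⋃ σ, copy σ) ⊆ Set.univ.pi fun _ => Set.Ioo 0 t :=
    Set.iUnion_subset fun σ s hs i _ => by simpa using hs.2 (σ.symm i)
  have cube_ne_top := (volume_pi_Ioo_lt_top (fun _ : Fin m => 0) fun _ => t).ne
  have volume_cube : volume.real (Set.univ.pi fun _ : Fin m => Set.Ioo 0 t) = t ^ m := by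
    rw [Measure.real, Real.volume_pi_Ioo_toReal fun _ => ht]
    simp
  rw [le_div_iff₀' (by positivity)]
  calc m ! * volume.real (simplex m t)
    _ = volume.real (⋃ σ, copy σ) := by
      rw [measureReal_iUnion_fintype disjoint_copies measurableSet_copy fun σ =>
        measure_ne_top_of_subset ((Set.subset_iUnion copy σ).trans copies_subset) cube_ne_top]
      simp [volume_copy, Fintype.card_perm]
    _ ≤ volume.real (Set.univ.pi fun _ : Fin m => Set.Ioo 0 t) :=
      measureReal_mono copies_subset cube_ne_top
    _ = t ^ m := volume_cube

end Simplex

section RiemannSums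

variable {X G ι : Type*} [MeasurableSpace X] {μ : Measure X} [NormedAddCommGroup G]
  [NormedSpace ℝ G] [CompleteSpace G]

theorem norm_measureReal_smul_sub_setIntegral_le {Q : Set X} {F : X → G} {y : G} {ε : ℝ}
    (hQ : μ Q < ⊤) (hF : IntegrableOn F Q μ) (hε : ∀ x ∈ Q, ‖y - F x‖ ≤ ε) :
    ‖μ.real Q • y - ∫ x in Q, F x ∂μ‖ ≤ ε * μ.real Q := by
  rw [← setIntegral_const, ← integral_sub (integrableOn_const (C := y) hQ.ne) hF]
  exact norm_setIntegral_le_of_norm_le_const hQ hε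

theorem norm_sum_measureReal_smul_sub_setIntegral_le [Fintype ι] {D : Set X} {Q : ι → Set X}
    {F : X → G} {y : ι → G} {A ε : ℝ} (hD : μ D < ⊤) (hQ : ∀ i, MeasurableSet (Q i))
    (hQD : ∀ i, Q i ⊆ D) (disjoint_Q : Pairwise (Function.onFun Disjoint Q))
    (hF : IntegrableOn F D μ) (hε : ∀ i, ∀ x ∈ Q i, ‖y i - F x‖ ≤ ε) (hA : ∀ x ∈ D, ‖F x‖ ≤ A) :
    ‖∑ i, μ.real (Q i) • y i - ∫ x in D, F x ∂μ‖ ≤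
      ε * μ.real (⋃ i, Q i) + A * μ.real (D \ ⋃ i, Q i) := by
  have union_subset : (⋃ i, Q i) ⊆ D := Set.iUnion_subset hQD
  have volume_Q_lt_top (i) : μ (Q i) < ⊤ := (measure_mono (hQD i)).trans_lt hD
  have integral_split :
      ∫ x in D, F x ∂μ = ∑ i, ∫ x in Q i, F x ∂μ + ∫ x in D \ ⋃ i, Q i, F x ∂μ := by
    rw [← integral_iUnion_fintype hQ disjoint_Q fun i => hF.mono_set (hQD i),
      setIntegral_sdiff (MeasurableSet.iUnion hQ) hF union_subset, add_sub_cancel]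
  have on_cells : ‖∑ i, (μ.real (Q i) • y i - ∫ x in Q i, F x ∂μ)‖ ≤ ε * μ.real (⋃ i, Q i) := by
    rw [measureReal_iUnion_fintype disjoint_Q hQ fun i => (volume_Q_lt_top i).ne, Finset.mul_sum]
    exact norm_sum_le_of_le _ fun i _ =>
      norm_measureReal_smul_sub_setIntegral_le (volume_Q_lt_top i) (hF.mono_set (hQD i)) (hε i)
  have off_cells : ‖∫ x in D \ ⋃ i, Q i, F x ∂μ‖ ≤ A * μ.real (D \ ⋃ i, Q i) :=
    norm_setIntegral_le_of_norm_le_const ((measure_mono Set.sdiff_subset).trans_lt hD)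
      fun x hx => hA x hx.1
  rw [integral_split, ← sub_sub, ← Finset.sum_sub_distrib]
  exact (norm_sub_le _ _).trans (add_le_add on_cells off_cells)

end RiemannSums

section Cells

variable {m m' n : ℕ} {Δt : ℝ}

/-- The time tuple formed by the midpoints of the steps selected by `κ`. An increasing selection of
`m` out of `n` steps is encoded as an order embedding `Fin m ↪o Fin n`. -/
noncomputable def gridPoint (Δt : ℝ) (κ : Fin m ↪o Fin n) : Fin m → ℝ :=
  fun a => stepMidpoint Δt (κ a)

/-- The cell of the midpoint rule around a pair of grid points: for the sup norm, the product of the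
open time steps selected by `κ.1` and `κ.2`. -/
noncomputable def gridCell (Δt : ℝ) (κ : (Fin m ↪o Fin n) × (Fin m' ↪o Fin n)) :
    Set ((Fin m → ℝ) × (Fin m' → ℝ)) :=
  Metric.ball (gridPoint Δt κ.1, gridPoint Δt κ.2) (Δt / 2)

theorem card_orderEmbedding_fin (m n : ℕ) : Fintype.card (Fin m ↪o Fin n) = n.choose m := by
  rw [← Nat.card_eq_fintype_card, Nat.card_congr Set.powersetCard.ofFinEmbEquiv,
    Set.powersetCard.card, Nat.card_fin]

theorem le_dist_stepMidpoint (hΔt : 0 ≤ Δt) {k l : ℕ} (hkl : k ≠ l) :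
    Δt ≤ dist (stepMidpoint Δt k) (stepMidpoint Δt l) := by
  have one_le : (1 : ℝ) ≤ |(k : ℝ) - l| := by
    exact_mod_cast Int.one_le_abs (sub_ne_zero.2 (Nat.cast_injective.ne hkl : (k : ℤ) ≠ l))
  calc Δt
    _ ≤ |(k : ℝ) - l| * |Δt| := by
      rw [abs_of_nonneg hΔt]
      exact le_mul_of_one_le_left hΔt one_le
    _ = dist (stepMidpoint Δt k) (stepMidpoint Δt l) := by
      rw [Real.dist_eq, stepMidpoint, stepMidpoint, ← sub_mul, add_sub_add_right_eq_sub, abs_mul]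

theorem le_dist_gridPoint (hΔt : 0 ≤ Δt) {κ κ' : Fin m ↪o Fin n} (hκ : κ ≠ κ') :
    Δt ≤ dist (gridPoint Δt κ) (gridPoint Δt κ') := by
  obtain ⟨a, ha⟩ := DFunLike.ne_iff.1 hκ
  exact (le_dist_stepMidpoint hΔt (Fin.val_ne_of_ne ha)).trans
    (dist_le_pi_dist (gridPoint Δt κ) (gridPoint Δt κ') a)

theorem pairwise_disjoint_gridCell (hΔt : 0 ≤ Δt) :
    Pairwise (Function.onFun Disjoint
      (gridCell (n := n) (m := m) (m' := m') Δt)) := fun κ κ' hκ => by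
  refine Metric.ball_disjoint_ball ((add_halves Δt).trans_le ?_)
  rw [Prod.dist_eq, le_max_iff]
  by_cases hκ₁ : κ.1 = κ'.1
  · exact Or.inr (le_dist_gridPoint hΔt fun hκ₂ => hκ (Prod.ext hκ₁ hκ₂))
  · exact Or.inl (le_dist_gridPoint hΔt hκ₁)

theorem ball_gridPoint_subset_simplex (hΔt : 0 < Δt) (κ : Fin m ↪o Fin n) :
    Metric.ball (gridPoint Δt κ) (Δt / 2) ⊆ simplex m (n * Δt) := fun s hs => by
  have mem_step (a) : (κ a : ℕ) * Δt < s a ∧ s a < ((κ a : ℕ) + 1) * Δt := by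
    have abs_lt_half := (dist_pi_lt_iff (half_pos hΔt)).1 hs a
    rw [Real.dist_eq, gridPoint, stepMidpoint, abs_lt] at abs_lt_half
    constructor <;> linarith
  refine ⟨fun a b hab => ?_, fun a => ⟨?_, ?_⟩⟩
  · have succ_le : ((κ a : ℕ) + 1 : ℝ) ≤ (κ b : ℕ) := by exact_mod_cast κ.strictMono hab
    exact (mem_step a).2.trans_le ((mul_le_mul_of_nonneg_right succ_le hΔt.le).trans
      (mem_step b).1.le)
  · exact (by positivity : 0 ≤ (κ a : ℕ) * Δt).trans_lt (mem_step a).1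
  · have succ_le : ((κ a : ℕ) + 1 : ℝ) ≤ n := by exact_mod_cast (κ a).is_lt
    exact (mem_step a).2.trans_le (mul_le_mul_of_nonneg_right succ_le hΔt.le)

theorem gridCell_subset_simplex_prod (hΔt : 0 < Δt) (κ : (Fin m ↪o Fin n) × (Fin m' ↪o Fin n)) :
    gridCell Δt κ ⊆ simplex m (n * Δt) ×ˢ simplex m' (n * Δt) := by
  rw [gridCell, ← ball_prod_same]
  exact Set.prod_mono (ball_gridPoint_subset_simplex hΔt κ.1)
    (ball_gridPoint_subset_simplex hΔt κ.2)

theorem measurableSet_gridCell (κ : (Fin m ↪o Fin n) × (Fin m' ↪o Fin n)) :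
    MeasurableSet (gridCell Δt κ) :=
  measurableSet_ball

theorem measureReal_gridCell (hΔt : 0 < Δt) (κ : (Fin m ↪o Fin n) × (Fin m' ↪o Fin n)) :
    volume.real (gridCell Δt κ) = Δt ^ m * Δt ^ m' := by
  have measureReal_ball {k : ℕ} (c : Fin k → ℝ) :
      volume.real (Metric.ball c (Δt / 2)) = Δt ^ k := by
    rw [Measure.real, Real.volume_pi_ball c (half_pos hΔt),
      ENNReal.toReal_ofReal (by positivity), mul_div_cancel₀ Δt two_ne_zero, Fintype.card_fin]
  rw [gridCell, ← ball_prod_same, Measure.volume_eq_prod, measureReal_prod_prod,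
    measureReal_ball, measureReal_ball]

theorem volume_simplex_prod_lt_top (m m' : ℕ) (t : ℝ) :
    volume (simplex m t ×ˢ simplex m' t) < ⊤ := by
  rw [Measure.volume_eq_prod, Measure.prod_prod]
  exact ENNReal.mul_lt_top (volume_simplex_lt_top m t) (volume_simplex_lt_top m' t)

theorem measureReal_simplex_prod_le (m m' : ℕ) {t : ℝ} (ht : 0 ≤ t) :
    volume.real (simplex m t ×ˢ simplex m' t) ≤ t ^ (m + m') / (m ! * m' !) := by
  rw [Measure.volume_eq_prod, measureReal_prod_prod, pow_add, mul_div_mul_comm]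
  exact mul_le_mul (measureReal_simplex_le m ht) (measureReal_simplex_le m' ht)
    measureReal_nonneg (by positivity)

theorem descFactorial_mul_pow_le (n m : ℕ) (hΔt : 0 ≤ Δt) :
    n.descFactorial m * Δt ^ m ≤ (n * Δt) ^ m := by
  rw [mul_pow]
  gcongr
  exact_mod_cast Nat.descFactorial_le_pow n m

theorem pow_sub_descFactorial_mul_pow_le (n m : ℕ) (hΔt : 0 ≤ Δt) :
    (n * Δt) ^ m - n.descFactorial m * Δt ^ m ≤ m ^ 2 * (1 + n * Δt) ^ m * Δt := by
  induction m with
  | zero => simp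
  | succ m ih =>
    set T : ℝ := n * Δt with T_def
    set d : ℝ := n.descFactorial m * Δt ^ m
    have T_nonneg : 0 ≤ T := by positivity
    have T_pow_le : T ^ m ≤ (1 + T) ^ m := by gcongr; linarith
    have d_le : d ≤ (1 + T) ^ m := (descFactorial_mul_pow_le n m hΔt).trans T_pow_le
    have step_le : d * (T - m * Δt) ≤ n.descFactorial (m + 1) * Δt ^ (m + 1) := by
      have sub_le : (n : ℝ) - m ≤ (n - m : ℕ) := sub_le_iff_le_add.2 (mod_cast le_tsub_add)
      rw [T_def, ← sub_mul, Nat.descFactorial_succ, pow_succ, Nat.cast_mul,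
        show d * ((n - m) * Δt) = (n - m) * n.descFactorial m * (Δt ^ m * Δt) by
          simp only [d]; ring]
      gcongr
    calc T ^ (m + 1) - n.descFactorial (m + 1) * Δt ^ (m + 1)
      _ ≤ T * (T ^ m - d) + m * d * Δt := by
        linear_combination step_le
      _ ≤ T * (m ^ 2 * (1 + T) ^ m * Δt) + m * (1 + T) ^ m * Δt := by gcongr
      _ ≤ (1 + T) * (m ^ 2 * (1 + T) ^ m * Δt) + (2 * m + 1) * (1 + T) ^ (m + 1) * Δt := by
        gcongr <;> linarith
      _ = (m + 1 : ℕ) ^ 2 * (1 + T) ^ (m + 1) * Δt := by push_cast; ring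

theorem pow_sub_descFactorial_mul_descFactorial_mul_pow_le (n m m' : ℕ) (hΔt : 0 ≤ Δt) :
    (n * Δt) ^ (m + m') - (n.descFactorial m * Δt ^ m) * (n.descFactorial m' * Δt ^ m') ≤
      (m + m' : ℕ) ^ 2 * (1 + n * Δt) ^ (m + m') * Δt := by
  set T : ℝ := n * Δt
  set d : ℝ := n.descFactorial m * Δt ^ m
  set d' : ℝ := n.descFactorial m' * Δt ^ m'
  have T_pow_le (k : ℕ) : T ^ k ≤ (1 + T) ^ k := by gcongr; linarith
  have d_le : d ≤ (1 + T) ^ m := (descFactorial_mul_pow_le n m hΔt).trans (T_pow_le m)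
  calc T ^ (m + m') - d * d'
    _ = T ^ m' * (T ^ m - d) + d * (T ^ m' - d') := by ring
    _ ≤ (1 + T) ^ m' * (m ^ 2 * (1 + T) ^ m * Δt) +
        (1 + T) ^ m * (m' ^ 2 * (1 + T) ^ m' * Δt) := by
      gcongr
      · exact sub_nonneg.2 (descFactorial_mul_pow_le n m hΔt)
      · exact le_add_of_nonneg_left zero_le_one
      · exact pow_sub_descFactorial_mul_pow_le n m hΔt
      · exact sub_nonneg.2 (descFactorial_mul_pow_le n m' hΔt)
      · exact pow_sub_descFactorial_mul_pow_le n m' hΔt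
    _ = (m ^ 2 + m' ^ 2) * (1 + T) ^ (m + m') * Δt := by ring
    _ ≤ (m + m' : ℕ) ^ 2 * (1 + T) ^ (m + m') * Δt := by
      gcongr
      rw [Nat.cast_add]
      exact pow_add_pow_le m.cast_nonneg m'.cast_nonneg two_ne_zero

theorem measureReal_iUnion_gridCell_le (n m m' : ℕ) (hΔt : 0 < Δt) :
    volume.real (⋃ κ : (Fin m ↪o Fin n) × (Fin m' ↪o Fin n), gridCell Δt κ) ≤
      (1 + n * Δt) ^ (m + m') / (m ! * m' !) :=
  calc volume.real (⋃ κ : (Fin m ↪o Fin n) × (Fin m' ↪o Fin n), gridCell Δt κ)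
    _ ≤ volume.real (simplex m (n * Δt) ×ˢ simplex m' (n * Δt)) :=
      measureReal_mono (Set.iUnion_subset (gridCell_subset_simplex_prod hΔt))
        (volume_simplex_prod_lt_top m m' _).ne
    _ ≤ (n * Δt) ^ (m + m') / (m ! * m' !) := measureReal_simplex_prod_le m m' (by positivity)
    _ ≤ (1 + n * Δt) ^ (m + m') / (m ! * m' !) := by
      gcongr
      exact le_add_of_nonneg_left zero_le_one

theorem measureReal_simplex_prod_diff_iUnion_gridCell_le (n m m' : ℕ) (hΔt : 0 < Δt) :
    volume.real ((simplex m (n * Δt) ×ˢ simplex m' (n * Δt)) \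
        ⋃ κ : (Fin m ↪o Fin n) × (Fin m' ↪o Fin n), gridCell Δt κ) ≤
      (m + m' : ℕ) ^ 2 * (1 + n * Δt) ^ (m + m') * Δt / (m ! * m' !) := by
  have volume_D_ne_top := (volume_simplex_prod_lt_top m m' (n * Δt)).ne
  have cell_subset := gridCell_subset_simplex_prod (n := n) (m := m) (m' := m') hΔt
  have choose_eq (k : ℕ) : (n.choose k : ℝ) = n.descFactorial k / k ! := by
    rw [Nat.descFactorial_eq_factorial_mul_choose, Nat.cast_mul,
      mul_div_cancel_left₀ _ (by positivity)]
  have measureReal_iUnion :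
      volume.real (⋃ κ : (Fin m ↪o Fin n) × (Fin m' ↪o Fin n), gridCell Δt κ) =
        (n.descFactorial m * Δt ^ m) * (n.descFactorial m' * Δt ^ m') / (m ! * m' !) := by
    rw [measureReal_iUnion_fintype (pairwise_disjoint_gridCell hΔt.le) measurableSet_gridCell
      fun κ => measure_ne_top_of_subset (cell_subset κ) volume_D_ne_top]
    simp only [measureReal_gridCell hΔt, Finset.sum_const, Finset.card_univ, Fintype.card_prod,
      card_orderEmbedding_fin, nsmul_eq_mul, Nat.cast_mul, choose_eq]
    ring
  rw [measureReal_sdiff (Set.iUnion_subset cell_subset) (.iUnion measurableSet_gridCell)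
    volume_D_ne_top, measureReal_iUnion]
  refine (sub_le_sub_right (measureReal_simplex_prod_le m m' (by positivity)) _).trans ?_
  rw [← sub_div]
  gcongr
  exact pow_sub_descFactorial_mul_descFactorial_mul_pow_le n m m' hΔt.le

end Cells

section DysonIntegrand

variable {E : Type*} [NormedAddCommGroup E] [InnerProductSpace ℂ E] [CompleteSpace E]
  {H : E →L[ℂ] E} {B : ℝ → ℝ → ℂ} {b b' : ℝ}

theorem norm_dysonIntegrand_le (hH : IsSelfAdjoint H)
    (hB : IsBoundedCorrelation B b b') (W ρ₀ : E →L[ℂ] E) (t : ℝ) {m m' : ℕ}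
    (p : (Fin m → ℝ) × (Fin m' → ℝ)) :
    ‖dysonIntegrand H W ρ₀ B t m m' p‖ ≤
      (pairings (m + m')).card * ((1 + b) * ‖W‖) ^ (m + m') * ‖ρ₀‖ := by
  have b_nonneg := hB.nonneg
  rw [dysonIntegrand, norm_smul]
  calc ‖influence B p.1 p.2‖ * ‖leftChain H W m t p.1 * ρ₀ * rightChain H W m' t p.2‖
    _ ≤ ((pairings (m + m')).card * (1 + b) ^ (m + m')) * (‖W‖ ^ (m + m') * ‖ρ₀‖) := by
      gcongr
      · exact norm_influence_le hB _ _
      · exact norm_leftChain_mul_mul_rightChain_le hH W ρ₀ t _ _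
    _ = (pairings (m + m')).card * ((1 + b) * ‖W‖) ^ (m + m') * ‖ρ₀‖ := by rw [mul_pow]; ring

theorem norm_dysonIntegrand_sub_le (hH : IsSelfAdjoint H)
    (hB : IsBoundedCorrelation B b b') (W ρ₀ : E →L[ℂ] E) {t : ℝ} {m m' : ℕ}
    {p q : (Fin m → ℝ) × (Fin m' → ℝ)} (hp : p ∈ simplex m t ×ˢ simplex m' t)
    (hq : q ∈ simplex m t ×ˢ simplex m' t) :
    ‖dysonIntegrand H W ρ₀ B t m m' p - dysonIntegrand H W ρ₀ B t m m' q‖ ≤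
      (pairings (m + m')).card * ((1 + b) * ‖W‖) ^ (m + m') * ‖ρ₀‖ *
        (2 * (b' + ‖H‖) * (m + m' : ℕ)) * dist p q := by
  have b_nonneg := hB.nonneg
  have b'_nonneg := hB.deriv_nonneg
  have telescope (x y : ℂ) (X Y : E →L[ℂ] E) : x • X - y • Y = (x - y) • X + y • (X - Y) := by
    module
  have influence_le := norm_influence_sub_le hB (p := p) (q := q) (fun i => (hp.1.2 i).1)
    (fun i => (hp.2.2 i).1) (fun i => (hq.1.2 i).1) fun i => (hq.2.2 i).1
  set N : ℝ := ((pairings (m + m')).card : ℝ)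
  set M := m + m'
  rw [dysonIntegrand, dysonIntegrand, telescope]
  refine (norm_add_le _ _).trans ?_
  rw [norm_smul, norm_smul]
  calc ‖influence B p.1 p.2 - influence B q.1 q.2‖ *
          ‖leftChain H W m t p.1 * ρ₀ * rightChain H W m' t p.2‖ +
        ‖influence B q.1 q.2‖ * ‖leftChain H W m t p.1 * ρ₀ * rightChain H W m' t p.2 -
          leftChain H W m t q.1 * ρ₀ * rightChain H W m' t q.2‖
    _ ≤ N * (M * (1 + b) ^ M * (2 * b' * dist p q)) * (‖W‖ ^ M * ‖ρ₀‖) +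
        N * (1 + b) ^ M * (‖W‖ ^ M * ‖ρ₀‖ * (2 * (M * ‖H‖) * dist p q)) := by
      gcongr
      · exact norm_leftChain_mul_mul_rightChain_le hH W ρ₀ t _ _
      · exact norm_influence_le hB _ _
      · exact norm_leftChain_mul_mul_rightChain_sub_le hH W ρ₀ t _ _
    _ = N * ((1 + b) * ‖W‖) ^ M * ‖ρ₀‖ * (2 * (b' + ‖H‖) * M) * dist p q := by
      rw [mul_pow]; ring

theorem continuousOn_dysonIntegrand (hH : IsSelfAdjoint H)
    (hB : IsBoundedCorrelation B b b') (W ρ₀ : E →L[ℂ] E) (t : ℝ) (m m' : ℕ) :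
    ContinuousOn (dysonIntegrand H W ρ₀ B t m m') (simplex m t ×ˢ simplex m' t) :=
  (LipschitzOnWith.of_dist_le' fun p hp q hq => by
    rw [dist_eq_norm]
    exact norm_dysonIntegrand_sub_le hH hB W ρ₀ hp hq).continuousOn

theorem integrableOn_dysonIntegrand (hH : IsSelfAdjoint H)
    (hB : IsBoundedCorrelation B b b') (W ρ₀ : E →L[ℂ] E) (t : ℝ) (m m' : ℕ) :
    IntegrableOn (dysonIntegrand H W ρ₀ B t m m') (simplex m t ×ˢ simplex m' t) :=
  IntegrableOn.of_bound (volume_simplex_prod_lt_top m m' t)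
    ((continuousOn_dysonIntegrand hH hB W ρ₀ t m m').aestronglyMeasurable
      ((measurableSet_simplex m t).prod (measurableSet_simplex m' t))) _
    (ae_of_all _ fun p => norm_dysonIntegrand_le hH hB W ρ₀ t p)

end DysonIntegrand

section DysonSeries

/-- `dysonMajorant K (m, m')` bounds, up to a constant factor, both the `(m, m')` term of the Dyson
series and its discretization error divided by the step size, for suitable values of `K`. -/
noncomputable def dysonMajorant (K : ℝ) (p : ℕ × ℕ) : ℝ :=
  (pairings (p.1 + p.2)).card * K ^ (p.1 + p.2) / (p.1 ! * p.2 !)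

theorem dysonMajorant_nonneg {K : ℝ} (hK : 0 ≤ K) (p : ℕ × ℕ) : 0 ≤ dysonMajorant K p := by
  unfold dysonMajorant
  positivity

theorem dysonMajorant_le (K : ℝ) (m m' : ℕ) :
    dysonMajorant K (m, m') ≤ (1 / 4) ^ m * (1 / 4) ^ m' +
      (8 * K ^ 2) ^ m / m ! * ((8 * K ^ 2) ^ m' / m' !) := by
  have card_sq_le : ((pairings (m + m')).card : ℝ) ^ 2 ≤ 2 ^ (m + m') * (m ! * m' !) :=
    mod_cast card_pairings_add_sq_le m m'
  set M := m + m' with M_def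
  set c : ℝ := (m ! * m' ! : ℝ)
  set x : ℝ := (1 / 2) ^ M with x_def
  -- The product `x * y` is split by AM-GM because only the square of `#pairings` is comparable to
  -- the factorials in `c`.
  set y : ℝ := (pairings M).card * (2 * K) ^ M / c with y_def
  have y_sq_le : y ^ 2 ≤ (8 * K ^ 2) ^ M / c :=
    calc y ^ 2
      _ = ((pairings M).card : ℝ) ^ 2 * ((2 * K) ^ 2) ^ M / c ^ 2 := by
        rw [y_def, div_pow, mul_pow, pow_right_comm]
      _ ≤ 2 ^ M * c * ((2 * K) ^ 2) ^ M / c ^ 2 := by gcongr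
      _ = (8 * K ^ 2) ^ M / c := by
        rw [show 8 * K ^ 2 = 2 * (2 * K) ^ 2 by ring, mul_pow 2 ((2 * K) ^ 2)]
        field_simp
  calc dysonMajorant K (m, m')
    _ = x * y := by
      change (pairings M).card * K ^ M / c = x * y
      rw [x_def, y_def, mul_pow 2, one_div, inv_pow]
      field_simp
    _ ≤ x ^ 2 + y ^ 2 := by nlinarith [sq_nonneg (x - y), sq_nonneg x, sq_nonneg y]
    _ ≤ (1 / 4) ^ M + (8 * K ^ 2) ^ M / c := by
      gcongr
      rw [x_def, pow_right_comm]
      norm_num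
    _ = (1 / 4) ^ m * (1 / 4) ^ m' + (8 * K ^ 2) ^ m / m ! * ((8 * K ^ 2) ^ m' / m' !) := by
      rw [M_def, pow_add, pow_add, mul_div_mul_comm]

theorem summable_dysonMajorant {K : ℝ} (hK : 0 ≤ K) : Summable (dysonMajorant K) := by
  have summable_geometric : Summable fun m : ℕ => (1 / 4 : ℝ) ^ m :=
    summable_geometric_of_lt_one (by norm_num) (by norm_num)
  have summable_exponential := Real.summable_pow_div_factorial (8 * K ^ 2)
  refine .of_nonneg_of_le (dysonMajorant_nonneg hK) (fun p => dysonMajorant_le K p.1 p.2)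
    ((summable_geometric.mul_of_nonneg summable_geometric ?_ ?_).add
      (summable_exponential.mul_of_nonneg summable_exponential ?_ ?_)) <;>
  · intro m
    positivity

variable {E : Type*} [NormedAddCommGroup E] [InnerProductSpace ℂ E] [CompleteSpace E]
  {H : E →L[ℂ] E} {B : ℝ → ℝ → ℂ} {b b' : ℝ}

theorem norm_neg_I_pow_mul_I_pow (m m' : ℕ) : ‖(-Complex.I) ^ m * Complex.I ^ m'‖ = 1 := by
  simp

theorem norm_dysonTerm_le (hH : IsSelfAdjoint H)
    (hB : IsBoundedCorrelation B b b') (W ρ₀ : E →L[ℂ] E) {t : ℝ} (ht : 0 ≤ t) (m m' : ℕ) :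
    ‖dysonTerm H W ρ₀ B t m m'‖ ≤ ‖ρ₀‖ * dysonMajorant ((1 + b) * ‖W‖ * t) (m, m') := by
  have b_nonneg := hB.nonneg
  rw [dysonTerm, norm_smul, norm_neg_I_pow_mul_I_pow, one_mul]
  calc ‖∫ p in simplex m t ×ˢ simplex m' t, dysonIntegrand H W ρ₀ B t m m' p‖
    _ ≤ (pairings (m + m')).card * ((1 + b) * ‖W‖) ^ (m + m') * ‖ρ₀‖ *
        volume.real (simplex m t ×ˢ simplex m' t) :=
      norm_setIntegral_le_of_norm_le_const (volume_simplex_prod_lt_top m m' t)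
        fun p _ => norm_dysonIntegrand_le hH hB W ρ₀ t p
    _ ≤ (pairings (m + m')).card * ((1 + b) * ‖W‖) ^ (m + m') * ‖ρ₀‖ *
        (t ^ (m + m') / (m ! * m' !)) := by
      gcongr
      exact measureReal_simplex_prod_le m m' ht
    _ = ‖ρ₀‖ * dysonMajorant ((1 + b) * ‖W‖ * t) (m, m') := by
      rw [dysonMajorant, mul_pow _ t]
      ring

theorem summable_dysonTerm (hH : IsSelfAdjoint H)
    (hB : IsBoundedCorrelation B b b') (W ρ₀ : E →L[ℂ] E) {t : ℝ} (ht : 0 ≤ t) :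
    Summable fun p : ℕ × ℕ => dysonTerm H W ρ₀ B t p.1 p.2 := by
  have b_nonneg := hB.nonneg
  exact .of_norm_bounded ((summable_dysonMajorant (by positivity)).mul_left ‖ρ₀‖)
    fun p => norm_dysonTerm_le hH hB W ρ₀ ht p.1 p.2

theorem hasSum_dysonTerm (hH : IsSelfAdjoint H)
    (hB : IsBoundedCorrelation B b b') (W ρ₀ : E →L[ℂ] E) {t : ℝ} (ht : 0 ≤ t) :
    HasSum (fun p : ℕ × ℕ => dysonTerm H W ρ₀ B t p.1 p.2) (reducedDensity H W ρ₀ B t) := by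
  have summable := summable_dysonTerm hH hB W ρ₀ ht
  rw [reducedDensity, ← summable.tsum_prod]
  exact summable.hasSum

end DysonSeries

section DiscreteSeries

variable {E : Type*} [NormedAddCommGroup E] [InnerProductSpace ℂ E] [CompleteSpace E]
  {B : ℝ → ℝ → ℂ} {b b' : ℝ} {H W : E →L[ℂ] E}

/-- The midpoint Riemann sum for the `(m, m')` term of the Dyson series at time `n Δt`; it collects
the summands of the discrete density in which `m` left and `m'` right steps carry the coupling. -/
noncomputable def discreteTerm (H W ρ₀ : E →L[ℂ] E) (B : ℝ → ℝ → ℂ) (Δt : ℝ) (n m m' : ℕ) :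
    E →L[ℂ] E :=
  ((-Complex.I) ^ m * Complex.I ^ m') •
    ∑ κ : (Fin m ↪o Fin n) × (Fin m' ↪o Fin n), (Δt ^ m * Δt ^ m') •
      dysonIntegrand H W ρ₀ B (n * Δt) m m' (gridPoint Δt κ.1, gridPoint Δt κ.2)

theorem ones_injective (n : ℕ) :
    Function.Injective (ones : (Fin n → Fin 2) → Finset (Fin n)) := fun j j' h => by
  funext k
  have eq_one_iff := Finset.ext_iff.1 h k
  simp only [ones, Finset.mem_filter, Finset.mem_univ, true_and] at eq_one_iff
  lia

theorem exists_eq_orderEmbOfFin_ones {m n : ℕ} (κ : Fin m ↪o Fin n) :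
    ∃ (j : Fin n → Fin 2) (h : (ones j).card = m), κ = (ones j).orderEmbOfFin h := by
  classical
  let j : Fin n → Fin 2 := fun k => if k ∈ Finset.univ.map κ.toEmbedding then 1 else 0
  have ones_j : ones j = Finset.univ.map κ.toEmbedding := by
    ext k
    simp [ones, j]
  exact ⟨j, by rw [ones_j, Finset.card_map, Finset.card_fin],
    Finset.orderEmbOfFin_unique' _ fun a => by simp [ones_j]⟩

/-- The increasing enumerations of the ones of two zero-one sequences, together with their
lengths. -/
noncomputable def onesEnum {n : ℕ} (j : (Fin n → Fin 2) × (Fin n → Fin 2)) :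
    Σ p : ℕ × ℕ, (Fin p.1 ↪o Fin n) × (Fin p.2 ↪o Fin n) :=
  ⟨((ones j.1).card, (ones j.2).card),
    ((ones j.1).orderEmbOfFin rfl, (ones j.2).orderEmbOfFin rfl)⟩

theorem bijective_onesEnum (n : ℕ) : Function.Bijective (onesEnum (n := n)) := by
  constructor
  · intro j j' h
    have range_left : Set.range ((ones j.1).orderEmbOfFin rfl) =
        Set.range ((ones j'.1).orderEmbOfFin rfl) := congrArg (fun x => Set.range x.2.1) h
    have range_right : Set.range ((ones j.2).orderEmbOfFin rfl) =
        Set.range ((ones j'.2).orderEmbOfFin rfl) := congrArg (fun x => Set.range x.2.2) h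
    simp only [Finset.range_orderEmbOfFin, Finset.coe_inj] at range_left range_right
    exact Prod.ext (ones_injective n range_left) (ones_injective n range_right)
  · rintro ⟨⟨m, m'⟩, (κ : Fin m ↪o Fin n), (κ' : Fin m' ↪o Fin n)⟩
    obtain ⟨j, rfl, rfl⟩ := exists_eq_orderEmbOfFin_ones κ
    obtain ⟨j', rfl, rfl⟩ := exists_eq_orderEmbOfFin_ones κ'
    exact ⟨(j, j'), rfl⟩

theorem influence_smul_prod_stepOp_eq (hH : IsSelfAdjoint H) (hW : IsSelfAdjoint W)
    (ρ₀ : E →L[ℂ] E) (B : ℝ → ℝ → ℂ) (Δt : ℝ) {n : ℕ} (j j' : Fin n → Fin 2) :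
    influence B (midTimes Δt j) (midTimes Δt j') •
        ((List.ofFn fun k => stepOp H W Δt (j k)).reverse.prod * ρ₀ *
          (List.ofFn fun k => star (stepOp H W Δt (j' k))).prod) =
      ((-Complex.I) ^ (ones j).card * Complex.I ^ (ones j').card) •
        (Δt ^ (ones j).card * Δt ^ (ones j').card) •
          dysonIntegrand H W ρ₀ B (n * Δt) _ _ (midTimes Δt j, midTimes Δt j') := by
  rw [prod_stepOp_eq_leftChain_midTimes, prod_star_stepOp_eq_rightChain_midTimes hH hW,
    dysonIntegrand, ← Complex.coe_smul]
  simp only [smul_mul_assoc, mul_smul_comm, smul_smul]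
  congr 1
  push_cast
  rw [← neg_mul, mul_pow, mul_pow]
  ring

theorem hasSum_discreteTerm (hH : IsSelfAdjoint H) (hW : IsSelfAdjoint W) (ρ₀ : E →L[ℂ] E)
    (B : ℝ → ℝ → ℂ) (Δt : ℝ) (n : ℕ) :
    HasSum (fun p : ℕ × ℕ => discreteTerm H W ρ₀ B Δt n p.1 p.2)
      (discreteDensity H W ρ₀ B Δt n) := by
  let term (x : Σ p : ℕ × ℕ, (Fin p.1 ↪o Fin n) × (Fin p.2 ↪o Fin n)) : E →L[ℂ] E :=
    ((-Complex.I) ^ x.1.1 * Complex.I ^ x.1.2) • (Δt ^ x.1.1 * Δt ^ x.1.2) •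
      dysonIntegrand H W ρ₀ B (n * Δt) x.1.1 x.1.2 (gridPoint Δt x.2.1, gridPoint Δt x.2.2)
  have hasSum_term : HasSum term (discreteDensity H W ρ₀ B Δt n) := by
    rw [← (Equiv.ofBijective _ (bijective_onesEnum n)).hasSum_iff, discreteDensity,
      ← Fintype.sum_prod_type']
    convert hasSum_fintype _ using 1
    exact Finset.sum_congr rfl fun j _ => influence_smul_prod_stepOp_eq hH hW ρ₀ B Δt j.1 j.2
  refine hasSum_term.sigma fun p => ?_
  rw [discreteTerm, Finset.smul_sum]
  exact hasSum_fintype _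

theorem sq_le_four_pow (k : ℕ) : k ^ 2 ≤ 4 ^ k :=
  calc k ^ 2
    _ ≤ (2 ^ k) ^ 2 := Nat.pow_le_pow_left Nat.lt_two_pow_self.le 2
    _ = 4 ^ k := pow_right_comm 2 k 2

theorem norm_discreteTerm_sub_dysonTerm_le (hH : IsSelfAdjoint H)
    (hB : IsBoundedCorrelation B b b') (W ρ₀ : E →L[ℂ] E) {Δt : ℝ} (hΔt : 0 < Δt) (n m m' : ℕ) :
    ‖discreteTerm H W ρ₀ B Δt n m m' - dysonTerm H W ρ₀ B (n * Δt) m m'‖ ≤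
      ‖ρ₀‖ * (b' + ‖H‖ + 1) *
        dysonMajorant (4 * ((1 + b) * ‖W‖) * (1 + n * Δt)) (m, m') * Δt := by
  have b_nonneg := hB.nonneg
  have b'_nonneg := hB.deriv_nonneg
  set M := m + m'
  set A : ℝ := (pairings M).card * ((1 + b) * ‖W‖) ^ M * ‖ρ₀‖ with A_def
  set R : ℝ := 1 + n * Δt
  set c : ℝ := (m ! * m' ! : ℝ)
  have cell_subset := gridCell_subset_simplex_prod (n := n) (m := m) (m' := m') hΔt
  have close_on_cell (κ : (Fin m ↪o Fin n) × (Fin m' ↪o Fin n)) (p) (hp : p ∈ gridCell Δt κ) :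
      ‖dysonIntegrand H W ρ₀ B (n * Δt) m m' (gridPoint Δt κ.1, gridPoint Δt κ.2) -
        dysonIntegrand H W ρ₀ B (n * Δt) m m' p‖ ≤ A * (2 * (b' + ‖H‖) * M) * (Δt / 2) :=
    (norm_dysonIntegrand_sub_le hH hB W ρ₀ (cell_subset κ (Metric.mem_ball_self (half_pos hΔt)))
      (cell_subset κ hp)).trans (by gcongr; exact (Metric.mem_ball'.1 hp).le)
  have riemann_sum_error := norm_sum_measureReal_smul_sub_setIntegral_le
    (volume_simplex_prod_lt_top m m' (n * Δt)) measurableSet_gridCell cell_subset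
    (pairwise_disjoint_gridCell hΔt.le) (integrableOn_dysonIntegrand hH hB W ρ₀ _ m m')
    close_on_cell fun p _ => norm_dysonIntegrand_le hH hB W ρ₀ _ p
  simp only [measureReal_gridCell hΔt] at riemann_sum_error
  rw [discreteTerm, dysonTerm, ← smul_sub, norm_smul, norm_neg_I_pow_mul_I_pow, one_mul]
  calc ‖∑ κ : (Fin m ↪o Fin n) × (Fin m' ↪o Fin n), (Δt ^ m * Δt ^ m') •
          dysonIntegrand H W ρ₀ B (n * Δt) m m' (gridPoint Δt κ.1, gridPoint Δt κ.2) -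
        ∫ p in simplex m (n * Δt) ×ˢ simplex m' (n * Δt), dysonIntegrand H W ρ₀ B (n * Δt) m m' p‖
    _ ≤ A * (2 * (b' + ‖H‖) * M) * (Δt / 2) * (R ^ M / c) + A * (M ^ 2 * R ^ M * Δt / c) := by
      refine riemann_sum_error.trans ?_
      gcongr
      · exact measureReal_iUnion_gridCell_le n m m' hΔt
      · exact measureReal_simplex_prod_diff_iUnion_gridCell_le n m m' hΔt
    _ = A * (R ^ M / c) * ((b' + ‖H‖) * M + M ^ 2) * Δt := by ring
    _ ≤ A * (R ^ M / c) * ((b' + ‖H‖) * 4 ^ M + 4 ^ M) * Δt := by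
      gcongr
      · exact_mod_cast (Nat.lt_pow_self (by norm_num : 1 < 4)).le
      · exact_mod_cast sq_le_four_pow M
    _ = ‖ρ₀‖ * (b' + ‖H‖ + 1) * dysonMajorant (4 * ((1 + b) * ‖W‖) * R) (m, m') * Δt := by
      rw [dysonMajorant, A_def, mul_pow _ R, mul_pow 4]
      ring

theorem norm_discreteDensity_sub_reducedDensity_le (hH : IsSelfAdjoint H) (hW : IsSelfAdjoint W)
    (hB : IsBoundedCorrelation B b b') (ρ₀ : E →L[ℂ] E) {Δt : ℝ} (hΔt : 0 < Δt) (n : ℕ) :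
    ‖discreteDensity H W ρ₀ B Δt n - reducedDensity H W ρ₀ B (n * Δt)‖ ≤
      ‖ρ₀‖ * (b' + ‖H‖ + 1) *
        (∑' p, dysonMajorant (4 * ((1 + b) * ‖W‖) * (1 + n * Δt)) p) * Δt := by
  have b_nonneg := hB.nonneg
  have hasSum_sub := (hasSum_discreteTerm hH hW ρ₀ B Δt n).sub
    (hasSum_dysonTerm hH hB W ρ₀ (t := n * Δt) (by positivity))
  have hasSum_majorant := (summable_dysonMajorant
    (K := 4 * ((1 + b) * ‖W‖) * (1 + n * Δt)) (by positivity)).hasSum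
  rw [← hasSum_sub.tsum_eq]
  exact tsum_of_norm_bounded ((hasSum_majorant.mul_left _).mul_right Δt)
    fun p => norm_discreteTerm_sub_dysonTerm_le hH hB W ρ₀ hΔt n p.1 p.2

end DiscreteSeries

end OpenDyson

theorem mainTheorem2 :
    ∃ C : ℝ → ℝ → ℝ → ℝ → ℝ → ℝ → ℝ,
      ∀ (E : Type*) [NormedAddCommGroup E] [InnerProductSpace ℂ E] [CompleteSpace E]
        (H W ρ₀ : E →L[ℂ] E) (B : ℝ → ℝ → ℂ) (b b' : ℝ),
        IsSelfAdjoint H → IsSelfAdjoint W → IsBoundedCorrelation B b b' →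
        ∀ (n : ℕ) (Δt : ℝ), 0 < Δt →
          (∀ m m' : ℕ, IntegrableOn (dysonIntegrand H W ρ₀ B (n * Δt) m m')
            (simplex m (n * Δt) ×ˢ simplex m' (n * Δt))) ∧
          Summable (fun p : ℕ × ℕ => dysonTerm H W ρ₀ B (n * Δt) p.1 p.2) ∧
          ‖discreteDensity H W ρ₀ B Δt n - reducedDensity H W ρ₀ B (n * Δt)‖ ≤
            C ‖H‖ ‖ρ₀‖ ‖W‖ b b' (n * Δt) * Δt := by
  refine ⟨fun h r w b b' T => r * (b' + h + 1) *
    ∑' p, dysonMajorant (4 * ((1 + b) * w) * (1 + T)) p, ?_⟩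
  intro E _ _ _ H W ρ₀ B b b' hH hW hB n Δt hΔt
  exact ⟨integrableOn_dysonIntegrand hH hB W ρ₀ (n * Δt),
    summable_dysonTerm hH hB W ρ₀ (by positivity),
    norm_discreteDensity_sub_reducedDensity_le hH hW hB ρ₀ hΔt n⟩
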